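/- Let $\Gamma$ be a discrete group (not necessarily countable), let $X$ be a $\Gamma$-space, i.e. a compact Hausdorff space on which $\Gamma$ acts by homeomorphisms, and let $H\le\Gamma$ be a subgroup. **Boundaries.** Let $G$ be a discrete group and let $X$, $Y$ be $G$-spaces. A *factor map* $\pi:Y\to X$ is a continuous $G$-equivariant surjection. It is a *strongly proximal extension* (for $G$) if for every regular Borel probability measure $\nu$ on $Y$ whose support lies in a fibre $\pi^{-1}(x)$, $x\in X$, there is $y\in Y$ with $\delta_y\in\overline{G\nu}$ (closure in the weak-$*$ topology). The action on $Y$ is *minimal* if every orbit is dense. The pair $(Y,\pi)$ is a *$(G,X)$-boundary* if $\pi$ is a strongly proximal extension and $G\curvearrowright Y$ is minimal. The action $G\curvearrowright Y$ is *topologically free* if $\{y : gy=y\}$ has empty interior for every $g\in G\setminus\{e\}$. **Crossed product.** Put $\alpha_s(f)=f\circ s^{-1}$ for $f\in C(X)=C(X,\mathbb C)$, $s\in\Gamma$. Let $\rho:C(X)\to\mathbb B(\mathcal H)$ be any faithful unital $*$-representation on a Hilbert space. On $\ell^2(\Gamma,\mathcal H)$ let $(\lambda(s)\xi)(t)=\xi(s^{-1}t)$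 and $(\sigma(f)\xi)(t)=\rho(\alpha_{t^{-1}}(f))\xi(t)$, and let $C(X)\rtimes_r\Gamma$ be the operator-norm closure of $\operatorname{span}\{\sigma(f)\lambda(s): f\in C(X),\,s\in\Gamma\}$; the algebra $C(X)$ is regarded as a subalgebra via $\sigma$. Let $\mathbb E:C(X)\rtimes_r\Gamma\to C(X)$ be the canonical conditional expectation, i.e. the bounded linear map with $\mathbb E(\sigma(f)\lambda(e))=f$ and $\mathbb E(\sigma(f)\lambda(s))=0$ for $s\ne e$. **Theorem.** Suppose that there is a $(\Gamma,X)$-boundary $(Y,\pi)$ such that the action $\Gamma\curvearrowright Y$ is topologically free and such that 1. $H\curvearrowright X$ is minimal; 2. for the restricted action $H\curvearrowright Y$, the map $\pi:Y\to X$ is a strongly proximal extension and $Y$ is minimal, i.e. $(Y,\pi)$ is an $(H,X)$-boundary. Then $H$ is $X$-plump: for every $\varepsilon>0$ and every $a\in C(X)\rtimes_r\Gamma$ there are $s_1,\dots,s_m\in H$ and non-negative functions $g_1,\dots,g_m\in C(X)$ with $\sum_{j=1}^m g_j^2=1$ such that $$\Bigl\|\sum_{j=1}^m g_j\,\lambda(s_j)\,a\,\lambda(s_j)^*\,g_j-\mathbb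 E(a)\Bigr\|<\varepsilon .$$ -/

import Mathlib

open MeasureTheory Topology
open scoped ComplexOrder ENNReal

set_option linter.unusedSectionVars false

noncomputable section

namespace GammaSpace

section Dynamics

variable (G : Type*) [Group G]
variable {X Y : Type*} [TopologicalSpace X] [MulAction G X] [TopologicalSpace Y] [MulAction G Y]

/-- Every non-identity element has a fixed-point set with empty interior. -/
def IsTopologicallyFree (Y : Type*) [TopologicalSpace Y] [MulAction G Y] : Prop :=
  ∀ g : G, g ≠ 1 → interior (MulAction.fixedBy Y g) = ∅

/-- A factor map (extension): a continuous equivariant surjection. -/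
structure IsFactorMap (π : Y → X) : Prop where
  continuous : Continuous π
  surjective : Function.Surjective π
  map_smul : ∀ (g : G) (y : Y), π (g • y) = g • π y

instance subgroupContinuousConstSMul {Γ Z : Type*} [Group Γ] [TopologicalSpace Z] [MulAction Γ Z]
    [ContinuousConstSMul Γ Z] (H : Subgroup Γ) : ContinuousConstSMul H Z :=
  ⟨fun h => continuous_const_smul (h : Γ)⟩

variable {G} in
/-- The push-forward `g ν` of a Borel probability measure under the homeomorphism `y ↦ g • y`. -/
def translateMeasure [ContinuousConstSMul G Y] [MeasurableSpace Y] [BorelSpace Y]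
    (g : G) (ν : ProbabilityMeasure Y) : ProbabilityMeasure Y :=
  ν.map (f := fun y : Y => g • y) (continuous_const_smul g).measurable.aemeasurable

/-- Every regular Borel probability measure `ν` on `Y` whose support lies in one fibre has a point
mass in its weak-* orbit closure. -/
structure IsStronglyProximalExtension [ContinuousConstSMul G Y] [MeasurableSpace Y] [BorelSpace Y]
    (π : Y → X) : Prop extends IsFactorMap G π where
  exists_dirac : ∀ (ν : ProbabilityMeasure Y), (ν : Measure Y).Regular →
    ∀ x : X, (ν : Measure Y).support ⊆ π ⁻¹' {x} →
      ∃ y : Y, diracProba y ∈ closure (Set.range fun g : G => translateMeasure g ν)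

/-- `(Y, π)` is a `(G, X)`-boundary: a minimal strongly proximal extension of `X`. -/
structure IsBoundary [ContinuousConstSMul G Y] [MeasurableSpace Y] [BorelSpace Y]
    (π : Y → X) : Prop extends IsStronglyProximalExtension G π where
  minimal : MulAction.IsMinimal G Y

end Dynamics

section CrossedProduct

/-- The Hilbert space `ℓ²(Γ, 𝓗)`. -/
abbrev L2 (Γ 𝓗 : Type*) [NormedAddCommGroup 𝓗] : Type _ := lp (fun _ : Γ => 𝓗) 2

variable {Γ : Type*} [Group Γ]
variable {𝓗 : Type*} [NormedAddCommGroup 𝓗] [InnerProductSpace ℂ 𝓗]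

lemma summable_sq (ξ : L2 Γ 𝓗) : Summable fun t => ‖ξ t‖ ^ (2 : ℝ≥0∞).toReal :=
  (lp.memℓp ξ).summable (by simp)

variable (𝓗) in
/-- Left translation `(λ_s ξ)(t) = ξ (s⁻¹ t)`. -/
def shift (s : Γ) : L2 Γ 𝓗 →L[ℂ] L2 Γ 𝓗 :=
  LinearMap.mkContinuous
    { toFun := fun ξ => ⟨fun t => ξ (s⁻¹ * t),
        memℓp_gen (((Equiv.mulLeft s⁻¹).summable_iff).2 (summable_sq ξ))⟩
      map_add' := fun _ _ => rfl
      map_smul' := fun _ _ => rfl }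
    1 (fun ξ => by
      refine lp.norm_le_of_tsum_le (by simp) (by positivity) ?_
      rw [one_mul, lp.norm_rpow_eq_tsum (by simp)]
      exact ((Equiv.mulLeft s⁻¹).tsum_eq fun t => ‖ξ t‖ ^ (2 : ℝ≥0∞).toReal).le)

@[simp] lemma shift_apply (s : Γ) (ξ : L2 Γ 𝓗) (t : Γ) : shift 𝓗 s ξ t = ξ (s⁻¹ * t) := rfl

variable {X : Type*} [TopologicalSpace X] [CompactSpace X] [MulAction Γ X]
  [ContinuousConstSMul Γ X]

/-- The induced action on functions, `α_s f = f ∘ s⁻¹`. -/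
def act (s : Γ) (f : C(X, ℂ)) : C(X, ℂ) := f.comp ⟨fun x => s⁻¹ • x, continuous_const_smul _⟩

@[simp] lemma act_apply (s : Γ) (f : C(X, ℂ)) (x : X) : act s f x = f (s⁻¹ • x) := rfl

lemma act_one (f : C(X, ℂ)) : act (1 : Γ) f = f := by ext x; simp

lemma norm_act_le (s : Γ) (f : C(X, ℂ)) : ‖act s f‖ ≤ ‖f‖ :=
  (ContinuousMap.norm_le _ (norm_nonneg f)).2 fun x => f.norm_coe_le_norm (s⁻¹ • x)

variable [CompleteSpace 𝓗] (ρ : C(X, ℂ) →⋆ₐ[ℂ] (𝓗 →L[ℂ] 𝓗))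

lemma norm_rep_act_le (s : Γ) (f : C(X, ℂ)) (v : 𝓗) : ‖ρ (act s f) v‖ ≤ ‖f‖ * ‖v‖ :=
  ((ρ (act s f)).le_opNorm v).trans <| mul_le_mul_of_nonneg_right
    ((NonUnitalStarAlgHom.norm_apply_le ρ _).trans (norm_act_le s f)) (norm_nonneg v)

lemma rep_rpow_le (f : C(X, ℂ)) (ξ : L2 Γ 𝓗) (t : Γ) :
    ‖ρ (act t⁻¹ f) (ξ t)‖ ^ (2 : ℝ≥0∞).toReal ≤
      ‖f‖ ^ (2 : ℝ≥0∞).toReal * ‖ξ t‖ ^ (2 : ℝ≥0∞).toReal := by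
  rw [← Real.mul_rpow (norm_nonneg _) (norm_nonneg _)]
  exact Real.rpow_le_rpow (norm_nonneg _) (norm_rep_act_le ρ _ _ _) (by simp)

lemma rep_summable (f : C(X, ℂ)) (ξ : L2 Γ 𝓗) :
    Summable fun t => ‖ρ (act t⁻¹ f) (ξ t)‖ ^ (2 : ℝ≥0∞).toReal :=
  Summable.of_nonneg_of_le (fun _ => by positivity) (rep_rpow_le ρ f ξ)
    ((summable_sq ξ).mul_left _)

variable (Γ) in
/-- `(σ(f) ξ)(t) = ρ(α_{t⁻¹} f) (ξ t)`. -/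
def sigma (f : C(X, ℂ)) : L2 Γ 𝓗 →L[ℂ] L2 Γ 𝓗 :=
  LinearMap.mkContinuous
    { toFun := fun ξ => ⟨fun t => ρ (act t⁻¹ f) (ξ t), memℓp_gen (rep_summable ρ f ξ)⟩
      map_add' := fun ξ η => by ext t; exact map_add (ρ (act t⁻¹ f)) (ξ t) (η t)
      map_smul' := fun c ξ => by ext t; exact map_smul (ρ (act t⁻¹ f)) c (ξ t) }
    ‖f‖ (fun ξ => by
      refine lp.norm_le_of_tsum_le (by simp) (by positivity) ?_
      rw [Real.mul_rpow (norm_nonneg _) (norm_nonneg _), lp.norm_rpow_eq_tsum (by simp),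
        ← tsum_mul_left]
      exact (rep_summable ρ f ξ).tsum_le_tsum (rep_rpow_le ρ f ξ) ((summable_sq ξ).mul_left _))

@[simp] lemma sigma_apply (f : C(X, ℂ)) (ξ : L2 Γ 𝓗) (t : Γ) :
    sigma Γ ρ f ξ t = ρ (act t⁻¹ f) (ξ t) := rfl

variable (Γ) in
/-- The reduced crossed product `C(X) ⋊_r Γ`: the operator-norm closure in `B(ℓ²(Γ, 𝓗))` of the
linear span of the elements `σ(f) λ_s`. -/
def reducedCrossedProduct : Submodule ℂ (L2 Γ 𝓗 →L[ℂ] L2 Γ 𝓗) :=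
  (Submodule.span ℂ {T | ∃ (f : C(X, ℂ)) (s : Γ), T = sigma Γ ρ f * shift 𝓗 s}).topologicalClosure

lemma sigma_mul_shift_mem (f : C(X, ℂ)) (s : Γ) :
    sigma Γ ρ f * shift 𝓗 s ∈ reducedCrossedProduct Γ ρ :=
  Submodule.le_topologicalClosure _ (Submodule.subset_span ⟨f, s, rfl⟩)

open Classical in
variable (Γ 𝓗) in
/-- The compression `T ↦ V* T V` to the copy `V : 𝓗 → ℓ²(Γ, 𝓗)` of `𝓗` sitting at `1 ∈ Γ`. -/
def compress : (L2 Γ 𝓗 →L[ℂ] L2 Γ 𝓗) →L[ℂ] (𝓗 →L[ℂ] 𝓗) :=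
  (ContinuousLinearMap.compL ℂ 𝓗 (L2 Γ 𝓗) 𝓗 (lp.evalCLM ℂ (fun _ : Γ => 𝓗) 2 1)) ∘L
    ((ContinuousLinearMap.compL ℂ 𝓗 (L2 Γ 𝓗) (L2 Γ 𝓗)).flip
      (lp.singleContinuousLinearMap ℂ (fun _ : Γ => 𝓗) 2 1))

open Classical in
lemma compress_apply (T : L2 Γ 𝓗 →L[ℂ] L2 Γ 𝓗) (v : 𝓗) :
    compress Γ 𝓗 T v = T (lp.single 2 1 v) 1 := rfl

open Classical in
lemma compress_sigma_mul_shift (f : C(X, ℂ)) (s : Γ) :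
    compress Γ 𝓗 (sigma Γ ρ f * shift 𝓗 s) = ρ (if s = 1 then f else 0) := by
  ext v
  rw [compress_apply, mul_apply_eq_comp, sigma_apply, shift_apply, inv_one, act_one,
    mul_one, lp.single_apply]
  by_cases hs : s = 1
  · simp [hs]
  · simp [hs]

variable {ρ}

/-- A faithful representation, as a linear isometry. -/
def repIsometry (hρ : Function.Injective ρ) : C(X, ℂ) →ₗᵢ[ℂ] (𝓗 →L[ℂ] 𝓗) where
  toLinearMap := ρ.toAlgHom.toLinearMap
  norm_map' := NonUnitalStarAlgHom.norm_map ρ hρ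

lemma compress_mem_range (hρ : Function.Injective ρ) (T : L2 Γ 𝓗 →L[ℂ] L2 Γ 𝓗) (hT : T ∈ reducedCrossedProduct Γ ρ) :
    compress Γ 𝓗 T ∈ LinearMap.range (repIsometry hρ).toLinearMap := by
  have hc : IsClosed ((LinearMap.range (repIsometry hρ).toLinearMap).comap
      (compress Γ 𝓗).toLinearMap : Set (L2 Γ 𝓗 →L[ℂ] L2 Γ 𝓗)) := by
    have h : IsClosed (Set.range (repIsometry hρ)) :=
      (repIsometry hρ).isometry.isClosedEmbedding.isClosed_range
    exact h.preimage (compress Γ 𝓗).continuous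
  refine Submodule.topologicalClosure_minimal _ (Submodule.span_le.2 ?_) hc hT
  rintro _ ⟨f, s, rfl⟩
  exact ⟨_, (compress_sigma_mul_shift ρ f s).symm⟩

/-- The canonical conditional expectation `𝔼 : C(X) ⋊_r Γ → C(X)`: the compression of `a` to the
coordinate `1 ∈ Γ` lies in `ρ(C(X))`, and `𝔼 a` is the corresponding function. -/
def condExp (hρ : Function.Injective ρ) : reducedCrossedProduct Γ ρ →L[ℂ] C(X, ℂ) :=
  ((repIsometry hρ).equivRange.symm.toContinuousLinearEquiv :
      LinearMap.range (repIsometry hρ).toLinearMap →L[ℂ] C(X, ℂ)) ∘L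
    ((compress Γ 𝓗 ∘L (reducedCrossedProduct Γ ρ).subtypeL).codRestrict
      (LinearMap.range (repIsometry hρ).toLinearMap)
      fun T => compress_mem_range hρ T.1 T.2)

lemma rep_condExp (hρ : Function.Injective ρ) (a : reducedCrossedProduct Γ ρ) :
    ρ (condExp hρ a) = compress Γ 𝓗 (a : L2 Γ 𝓗 →L[ℂ] L2 Γ 𝓗) :=
  congrArg Subtype.val ((repIsometry hρ).equivRange.apply_symm_apply
    ⟨compress Γ 𝓗 (a : L2 Γ 𝓗 →L[ℂ] L2 Γ 𝓗), compress_mem_range hρ a.1 a.2⟩)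

open Classical in
/-- `𝔼(σ(f) λ_s) = f` if `s = 1`, and `0` otherwise. -/
lemma condExp_sigma_mul_shift (hρ : Function.Injective ρ) (f : C(X, ℂ)) (s : Γ) :
    condExp hρ ⟨sigma Γ ρ f * shift 𝓗 s, sigma_mul_shift_mem ρ f s⟩ = if s = 1 then f else 0 :=
  hρ ((rep_condExp hρ _).trans (compress_sigma_mul_shift ρ f s))

/-- The subgroup `H` of `Γ` is `X`-plump (the crossed product being formed with the faithful
representation `ρ`). -/
def IsPlump (hρ : Function.Injective ρ) (H : Subgroup Γ) : Prop :=
  ∀ ε : ℝ, 0 < ε → ∀ a : reducedCrossedProduct Γ ρ,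
    ∃ (m : ℕ) (s : Fin m → Γ) (g : Fin m → C(X, ℂ)),
      (∀ j, s j ∈ H) ∧ (∀ j, 0 ≤ g j) ∧ ∑ j, g j ^ 2 = 1 ∧
      ‖∑ j, sigma Γ ρ (g j) * shift 𝓗 (s j) * (a : L2 Γ 𝓗 →L[ℂ] L2 Γ 𝓗) *
          star (shift 𝓗 (s j)) * sigma Γ ρ (g j) - sigma Γ ρ (condExp hρ a)‖ < ε

end CrossedProduct

end GammaSpace

end

noncomputable section

namespace GammaSpace

section Partitions

variable {X : Type*} [TopologicalSpace X] [CompactSpace X] [T2Space X]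

/-- A compact Hausdorff space has, for every neighbourhood assignment, a finite quadratic partition
of unity subordinate to it. -/
lemma exists_quadratic_partition (V : X → Set X) (hV : ∀ x, V x ∈ 𝓝 x) :
    ∃ (T : Finset X) (h : T → C(X, ℝ)), (∀ i z, 0 ≤ h i z) ∧ (∀ z, ∑ i, h i z ^ 2 = 1) ∧
      ∀ i z, h i z ≠ 0 → z ∈ V i := by
  obtain ⟨T, hT⟩ := CompactSpace.elim_nhds_subcover (fun x => interior (V x))
    (fun x => interior_mem_nhds.2 (hV x))
  obtain ⟨p, hp⟩ := PartitionOfUnity.exists_isSubordinate (s := (Set.univ : Set X)) isClosed_univ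
    (fun i : T => interior (V i)) (fun _ => isOpen_interior) (by
      intro z _
      have hz : z ∈ ⋃ x ∈ T, interior (V x) := by rw [hT]; trivial
      simpa using hz)
  refine ⟨T, fun i => ⟨fun z => √(p i z), by fun_prop⟩, fun i z => Real.sqrt_nonneg _,
    fun z => ?_, fun i z hz => ?_⟩
  · have h1 := p.sum_eq_one (Set.mem_univ z)
    rw [finsum_eq_sum_of_fintype] at h1
    rw [← h1]
    exact Finset.sum_congr rfl fun i _ => Real.sq_sqrt (p.nonneg i z)
  · refine interior_subset (hp i (subset_tsupport _ fun h0 => hz ?_))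
    simp [h0]

end Partitions

section Proximality

variable {G : Type*} [Group G]
variable {X Y : Type*} [TopologicalSpace X] [T2Space X] [MulAction G X]
  [TopologicalSpace Y] [CompactSpace Y] [T2Space Y] [MulAction G Y]

/-- A positive linear functional of total mass one on `C(Y, ℝ)` that vanishes on the functions
vanishing on a closed set `K` is the integral of a regular probability measure supported in `K`. -/
lemma exists_probabilityMeasure_of_functional [MeasurableSpace Y] [BorelSpace Y]
    {K : Set Y} (hK : IsClosed K) (Λ : C(Y, ℝ) →ₗ[ℝ] ℝ)
    (hpos : ∀ v : C(Y, ℝ), (∀ y, 0 ≤ v y) → 0 ≤ Λ v) (hone : Λ 1 = 1)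
    (hzero : ∀ v : C(Y, ℝ), (∀ y ∈ K, v y = 0) → Λ v = 0) :
    ∃ ν : ProbabilityMeasure Y, (ν : Measure Y).Regular ∧ (ν : Measure Y).support ⊆ K ∧
      ∀ v : C(Y, ℝ), ∫ y, v y ∂(ν : Measure Y) = Λ v := by
  let M : CompactlySupportedContinuousMap Y ℝ →ₚ[ℝ] ℝ := PositiveLinearMap.mk₀
    { toFun := fun v => Λ v.toContinuousMap
      map_add' := fun v w => map_add Λ v.toContinuousMap w.toContinuousMap
      map_smul' := fun c v => map_smul Λ c v.toContinuousMap }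
    (fun v hv => hpos _ hv)
  have hint : ∀ v : C(Y, ℝ), ∫ y, v y ∂(RealRMK.rieszMeasure M) = Λ v := fun v =>
    RealRMK.integral_rieszMeasure M (CompactlySupportedContinuousMap.continuousMapEquiv v)
  have hreg : (RealRMK.rieszMeasure M).Regular := RealRMK.regular_rieszMeasure M
  have hfin : IsFiniteMeasure (RealRMK.rieszMeasure M) := inferInstance
  have hprob : IsProbabilityMeasure (RealRMK.rieszMeasure M) := by
    have h1 := hint 1
    rw [hone] at h1
    simp only [ContinuousMap.one_apply, integral_const, smul_eq_mul, mul_one] at h1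
    exact isProbabilityMeasure_iff_real.2 h1
  refine ⟨⟨RealRMK.rieszMeasure M, hprob⟩, hreg, fun y hy => ?_, hint⟩
  by_contra hyK
  obtain ⟨v, hvK, hvy, hv01⟩ := exists_continuous_zero_one_of_isClosed hK
    (isClosed_singleton (x := y)) (Set.disjoint_singleton_right.2 hyK)
  have h0 : ∫ z, v z ∂(RealRMK.rieszMeasure M) = 0 := (hint v).trans (hzero v fun z hz => hvK hz)
  rw [integral_eq_zero_iff_of_nonneg (fun z => (hv01 z).1)
    (v.continuous.integrable_of_hasCompactSupport (HasCompactSupport.of_compactSpace _))] at h0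
  refine (Measure.notMem_support_iff_exists.2 ⟨{z | v z ≠ 0}, ?_, h0⟩) hy
  refine (isOpen_ne_fun v.continuous continuous_const).mem_nhds ?_
  simp [hvy rfl]

/-- Along a boundary map, a bump at a point can be averaged over the group so as to be almost one on
a prescribed fibre. -/
lemma IsBoundary.exists_average [MeasurableSpace Y] [BorelSpace Y] [ContinuousConstSMul G Y]
    {π : Y → X} (hπ : IsBoundary G π) (x : X) (χ : C(Y, ℝ)) (y₀ : Y) (hχ : χ y₀ = 1)
    {ε : ℝ} (hε : 0 < ε) :
    ∃ (n : ℕ) (c : Fin n → ℝ) (s : Fin n → G), (∀ j, 0 ≤ c j) ∧ ∑ j, c j = 1 ∧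
      ∀ y, π y = x → 1 - ε < ∑ j, c j * χ ((s j)⁻¹ • y) := by
  let tr : G → C(Y, ℝ) := fun g => χ.comp ⟨fun y => g⁻¹ • y, continuous_const_smul _⟩
  let K : Set Y := π ⁻¹' {x}
  have hK : IsClosed K := isClosed_singleton.preimage hπ.continuous
  let W : Set C(Y, ℝ) := {u | ∀ y ∈ K, 1 - ε < u y}
  have hWopen : IsOpen W := ContinuousMap.isOpen_setOfPred_mapsTo hK.isCompact isOpen_Ioi
  have hWconv : Convex ℝ W := by
    intro u hu v hv a b ha hb hab y hy
    exact (convex_Ioi (1 - ε)) (hu y hy) (hv y hy) ha hb hab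
  by_cases hdisj : Disjoint W (convexHull ℝ (Set.range tr))
  · exfalso
    obtain ⟨f, c, hfW, hfC⟩ :=
      geometric_hahn_banach_open hWconv hWopen (convex_convexHull ℝ _) hdisj
    have hmem : ∀ v : C(Y, ℝ), (∀ y ∈ K, 0 ≤ v y) → ∀ n : ℕ, f 1 + n * f v < c := by
      intro v hv n
      have h := hfW (1 + (n : ℝ) • v) (fun y hy => by
        have := mul_nonneg (Nat.cast_nonneg n : (0 : ℝ) ≤ n) (hv y hy)
        simp only [ContinuousMap.add_apply, ContinuousMap.one_apply, ContinuousMap.smul_apply,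
          smul_eq_mul]
        linarith)
      simpa using h
    have hneg : ∀ v : C(Y, ℝ), (∀ y ∈ K, 0 ≤ v y) → f v ≤ 0 := by
      intro v hv
      by_contra! hlt
      obtain ⟨n, hn⟩ := exists_nat_gt ((c - f 1) / f v)
      rw [div_lt_iff₀ hlt] at hn
      linarith [hmem v hv n]
    have hzero : ∀ v : C(Y, ℝ), (∀ y ∈ K, v y = 0) → f v = 0 := by
      intro v hv
      have h1 := hneg v fun y hy => (hv y hy).ge
      have h2 := hneg (-v) fun y hy => by simp [hv y hy]
      rw [map_neg] at h2
      linarith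
    have hc : ∀ g, c ≤ f (tr g) := fun g => hfC _ (subset_convexHull ℝ _ ⟨g, rfl⟩)
    have hone : f 1 < 0 := by
      refine lt_of_le_of_ne (hneg 1 fun _ _ => zero_le_one) fun h1 => ?_
      have h2 : f (tr 1) = 0 := by
        refine le_antisymm ?_ ?_
        · have := hneg (tr 1 + ‖tr 1‖ • (1 : C(Y, ℝ))) fun y _ => by
            have := neg_le_of_abs_le ((tr 1).norm_coe_le_norm y)
            simpa using by linarith
          simpa [h1] using this
        · have := hneg (‖tr 1‖ • (1 : C(Y, ℝ)) - tr 1) fun y _ => by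
            have := le_of_abs_le ((tr 1).norm_coe_le_norm y)
            simpa using this
          simpa [h1] using this
      have h3 := hmem 0 (fun _ _ => le_rfl) 0
      have h4 := hc 1
      simp [h1] at h3
      linarith
    have hcle : (1 - ε) * f 1 ≤ c := by
      refine le_of_forall_pos_lt_add fun δ hδ => ?_
      have h := hfW ((1 - ε + δ / (-f 1)) • (1 : C(Y, ℝ))) (fun y _ => by
        have : 0 < δ / (-f 1) := by have := neg_pos.2 hone; positivity
        simpa using this)
      rw [map_smul, smul_eq_mul, add_mul, div_mul_eq_mul_div, div_neg,
        mul_div_cancel_right₀ _ hone.ne] at h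
      linarith
    have hinv : (f 1)⁻¹ < 0 := inv_lt_zero.2 hone
    obtain ⟨ν, hνreg, hνsupp, hνint⟩ := exists_probabilityMeasure_of_functional hK
      ((f 1)⁻¹ • (f : C(Y, ℝ) →ₗ[ℝ] ℝ))
      (fun v hv => mul_nonneg_of_nonpos_of_nonpos hinv.le (hneg v fun y _ => hv y))
      (inv_mul_cancel₀ hone.ne) (fun v hv => by simp [hzero v hv])
    obtain ⟨y₁, hy₁⟩ := hπ.exists_dirac ν hνreg x hνsupp
    obtain ⟨_, ⟨h, rfl⟩, hlt⟩ := (hπ.minimal.dense_orbit y₁).exists_mem_open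
      (U := {y | 1 - ε < χ y}) (isOpen_lt continuous_const χ.continuous) ⟨y₀, by simpa [hχ]⟩
    have hopen : IsOpen {μ : ProbabilityMeasure Y | 1 - ε <
        ∫ y, BoundedContinuousFunction.mkOfCompact (tr h⁻¹) y ∂(μ : Measure Y)} :=
      isOpen_lt continuous_const
        (ProbabilityMeasure.continuous_integral_boundedContinuousFunction _)
    obtain ⟨_, hμ, ⟨g, rfl⟩⟩ := mem_closure_iff.1 hy₁ _ hopen (by
      change 1 - ε < ∫ y, tr h⁻¹ y ∂(Measure.dirac y₁)
      rw [integral_dirac' _ _ (tr h⁻¹).continuous.stronglyMeasurable]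
      simpa [tr] using hlt)
    have hμ' : 1 - ε < ∫ y, tr (h * g)⁻¹ y ∂(ν : Measure Y) := by
      have h1 : 1 - ε < ∫ y, tr h⁻¹ y ∂((ν : Measure Y).map fun y => g • y) := hμ
      rw [integral_map (continuous_const_smul g).measurable.aemeasurable
        (tr h⁻¹).continuous.stronglyMeasurable.aestronglyMeasurable] at h1
      simpa [tr, mul_smul] using h1
    rw [hνint] at hμ'
    have h5 : (f 1)⁻¹ * f (tr (h * g)⁻¹) ≤ 1 - ε := by
      have := mul_le_mul_of_nonpos_left (hcle.trans (hc (h * g)⁻¹)) hinv.le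
      rwa [mul_comm (1 - ε), inv_mul_cancel_left₀ hone.ne] at this
    exact absurd hμ' (not_lt.2 h5)
  · obtain ⟨u, huW, huC⟩ := Set.not_disjoint_iff.1 hdisj
    obtain ⟨ι, _, w, z, hw, hw1, hz, rfl⟩ := mem_convexHull_iff_exists_fintype.1 huC
    choose s hs using hz
    let e := (Fintype.equivFin ι).symm
    refine ⟨Fintype.card ι, fun j => w (e j), fun j => s (e j), fun j => hw _, ?_, fun y hy => ?_⟩
    · rw [← hw1]; exact e.sum_comp w
    · rw [e.sum_comp fun i => w i * χ ((s i)⁻¹ • y)]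
      have := huW y hy
      simp only [← hs, ContinuousMap.coe_sum, Finset.sum_apply] at this
      exact this

end Proximality

section Averaging

variable {Γ : Type*} [Group Γ]
variable {X Y : Type*} [TopologicalSpace X] [CompactSpace X] [T2Space X] [MulAction Γ X]
  [TopologicalSpace Y] [CompactSpace Y] [T2Space Y] [MulAction Γ Y] [ContinuousConstSMul Γ Y]

/-- For a topologically free action, every non-empty open set carries a bump function that finitely
many given non-trivial group elements move off itself. -/
lemma IsTopologicallyFree.exists_bump (hfree : IsTopologicallyFree Γ Y) (F : Finset Γ)
    (hF : ∀ t ∈ F, t ≠ 1) {O : Set Y} (hO : IsOpen O) (hne : O.Nonempty) :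
    ∃ (χ : C(Y, ℝ)) (y₀ : Y), χ y₀ = 1 ∧ (∀ y, 0 ≤ χ y ∧ χ y ≤ 1) ∧ (∀ y, χ y ≠ 0 → y ∈ O) ∧
      ∀ t ∈ F, ∀ y, χ y * χ (t⁻¹ • y) = 0 := by
  have hdense : Dense (⋂ t ∈ (F : Set Γ), (MulAction.fixedBy Y t)ᶜ) := by
    refine dense_biInter_of_isOpen (fun t _ => ?_) F.countable_toSet fun t ht => ?_
    · exact (isClosed_eq (continuous_const_smul t) continuous_id).isOpen_compl
    · exact interior_eq_empty_iff_dense_compl.1 (hfree t (hF t ht))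
  obtain ⟨y₀, hy₀, hy₀O⟩ := hdense.exists_mem_open hO hne
  have hsep : ∀ t ∈ F, ∃ U : Set Y, IsOpen U ∧ y₀ ∈ U ∧ ∀ y, y ∈ U → t⁻¹ • y ∉ U := by
    intro t ht
    have hty : t • y₀ ≠ y₀ := fun h => Set.mem_iInter₂.1 hy₀ t ht h
    obtain ⟨A, B, hA, hB, hyA, hyB, hAB⟩ := t2_separation hty
    refine ⟨B ∩ (fun y => t • y) ⁻¹' A, hB.inter (hA.preimage (continuous_const_smul t)),
      ⟨hyB, hyA⟩, fun y hy hty => ?_⟩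
    have h2 : t • t⁻¹ • y ∈ A := hty.2
    rw [smul_inv_smul] at h2
    exact Set.disjoint_left.1 hAB h2 hy.1
  choose! U hUo hyU hU using hsep
  have hVo : IsOpen (O ∩ ⋂ t ∈ F, U t) := hO.inter (isOpen_biInter_finset hUo)
  obtain ⟨χ, hχ0, hχ1, hχ⟩ := exists_continuous_zero_one_of_isClosed hVo.isClosed_compl
    (isClosed_singleton (x := y₀))
    (Set.disjoint_singleton_right.2 fun h => h ⟨hy₀O, Set.mem_iInter₂.2 hyU⟩)
  have hsupp : ∀ y, χ y ≠ 0 → y ∈ O ∩ ⋂ t ∈ F, U t := fun y hy => by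
    by_contra h
    exact hy (hχ0 h)
  refine ⟨χ, y₀, hχ1 rfl, hχ, fun y hy => (hsupp y hy).1, fun t ht y => ?_⟩
  by_contra h
  have h1 := Set.mem_iInter₂.1 (hsupp y (left_ne_zero_of_mul h)).2 t ht
  have h2 := Set.mem_iInter₂.1 (hsupp _ (right_ne_zero_of_mul h)).2 t ht
  exact hU t ht y h1 h2

variable [MeasurableSpace Y] [BorelSpace Y]

/-- Local form of the averaging data: near a point of `X` a convex combination of elements of `H`
moves most of the mass into a set displaced by `F`, and barely moves `f`. -/
lemma IsBoundary.exists_local_average {H : Subgroup Γ} {π : Y → X} (hHY : IsBoundary H π)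
    (hfree : IsTopologicallyFree Γ Y) (F : Finset Γ) (hF : ∀ t ∈ F, t ≠ 1) (f : C(X, ℂ))
    {ε : ℝ} (hε : 0 < ε) (x : X) :
    ∃ (n : ℕ) (c : Fin n → ℝ) (s : Fin n → H) (χ : C(Y, ℝ)) (V : Set X), V ∈ 𝓝 x ∧
      (∀ j, 0 ≤ c j) ∧ ∑ j, c j = 1 ∧ (∀ y, 0 ≤ χ y ∧ χ y ≤ 1) ∧
      (∀ t ∈ F, ∀ y, χ y * χ (t⁻¹ • y) = 0) ∧
      (∀ y, π y ∈ V → ∑ j, c j * (1 - χ ((s j)⁻¹ • y)) ≤ ε) ∧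
      ∀ z ∈ V, ‖∑ j, (c j : ℂ) * f ((s j)⁻¹ • z) - f z‖ ≤ ε := by
  have hπ := hHY.continuous
  obtain ⟨δ, hδ, hδ'⟩ : ∃ δ : ℝ, 0 < δ ∧ δ * (2 + 2 * ‖f‖) = ε :=
    ⟨ε / (2 + 2 * ‖f‖), by positivity, div_mul_cancel₀ _ (by positivity)⟩
  have hδε : δ ≤ ε := by nlinarith [norm_nonneg f]
  obtain ⟨y', hy'⟩ := hHY.surjective x
  let O : Set Y := {y | ‖f (π y) - f x‖ < δ}
  obtain ⟨χ, y₀, hχ1, hχ, hχO, hχF⟩ := hfree.exists_bump F hF (O := O)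
    (isOpen_lt (by fun_prop) continuous_const) ⟨y', by simpa [O, hy'] using hδ⟩
  obtain ⟨n, c, s, hc, hc1, hcs⟩ := hHY.exists_average x χ y₀ hχ1 hδ
  have hscont : ∀ j, Continuous fun y : Y => (s j)⁻¹ • y := fun j => continuous_const_smul _
  let B : Set Y := {y | 1 - δ < ∑ j, c j * χ ((s j)⁻¹ • y)}
  have hB : IsOpen B := isOpen_lt continuous_const (by fun_prop)
  have hV1 : (π '' Bᶜ)ᶜ ∈ 𝓝 x := by
    refine (hB.isClosed_compl.isCompact.image hπ).isClosed.isOpen_compl.mem_nhds ?_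
    rintro ⟨y, hyB, hyx⟩
    exact hyB (hcs y hyx)
  have hV2 : {z | ‖f z - f x‖ < δ} ∈ 𝓝 x :=
    (isOpen_lt (by fun_prop) continuous_const).mem_nhds (by simpa using hδ)
  have hmass : ∀ y, π y ∈ (π '' Bᶜ)ᶜ → ∑ j, c j * (1 - χ ((s j)⁻¹ • y)) ≤ δ := by
    intro y hy
    have hyB : y ∈ B := by
      by_contra h
      exact hy ⟨y, h, rfl⟩
    simp only [mul_sub, mul_one, Finset.sum_sub_distrib, hc1]
    have : 1 - δ < ∑ j, c j * χ ((s j)⁻¹ • y) := hyB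
    linarith
  refine ⟨n, c, s, χ, _, Filter.inter_mem hV1 hV2, hc, hc1, hχ, hχF,
    fun y hy => (hmass y hy.1).trans hδε, ?_⟩
  rintro z ⟨hz1, hz2⟩
  obtain ⟨y, rfl⟩ := hHY.surjective z
  have hterm : ∀ j, ‖f ((s j)⁻¹ • π y) - f (π y)‖ ≤
      2 * δ + 2 * ‖f‖ * (1 - χ ((s j)⁻¹ • y)) := by
    intro j
    have h1 := (hχ ((s j)⁻¹ • y)).2
    by_cases h0 : χ ((s j)⁻¹ • y) = 0
    · have h2 := norm_sub_le (f ((s j)⁻¹ • π y)) (f (π y))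
      have h3 := f.norm_coe_le_norm ((s j)⁻¹ • π y)
      have h4 := f.norm_coe_le_norm (π y)
      rw [h0]
      linarith
    · have h2 : ‖f (π ((s j)⁻¹ • y)) - f x‖ < δ := hχO _ h0
      rw [hHY.map_smul] at h2
      have h3 : ‖f (π y) - f x‖ < δ := hz2
      have h4 := norm_sub_le (f ((s j)⁻¹ • π y) - f x) (f (π y) - f x)
      rw [sub_sub_sub_cancel_right] at h4
      have h5 := mul_nonneg (by positivity : 0 ≤ 2 * ‖f‖) (sub_nonneg.2 h1)
      linarith
  have hsum : ∑ j, (c j : ℂ) * f ((s j)⁻¹ • π y) - f (π y) =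
      ∑ j, (c j : ℂ) * (f ((s j)⁻¹ • π y) - f (π y)) := by
    simp only [mul_sub, Finset.sum_sub_distrib, ← Finset.sum_mul, ← Complex.ofReal_sum, hc1,
      Complex.ofReal_one, one_mul]
  calc ‖∑ j, (c j : ℂ) * f ((s j)⁻¹ • π y) - f (π y)‖
      ≤ ∑ j, c j * (2 * δ + 2 * ‖f‖ * (1 - χ ((s j)⁻¹ • y))) := by
        rw [hsum]
        refine norm_sum_le_of_le _ fun j _ => ?_
        rw [norm_mul, Complex.norm_real, Real.norm_of_nonneg (hc j)]
        exact mul_le_mul_of_nonneg_left (hterm j) (hc j)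
    _ = 2 * δ + 2 * ‖f‖ * ∑ j, c j * (1 - χ ((s j)⁻¹ • y)) := by
        simp only [mul_add, Finset.sum_add_distrib, ← Finset.sum_mul, hc1, one_mul, Finset.mul_sum]
        congr 1
        exact Finset.sum_congr rfl fun j _ => by ring
    _ ≤ 2 * δ + 2 * ‖f‖ * δ := by
        have := mul_le_mul_of_nonneg_left (hmass y hz1) (by positivity : 0 ≤ 2 * ‖f‖)
        linarith
    _ = ε := by rw [← hδ']; ring

/-- Global averaging data: a quadratic partition of unity on `X` with elements of `H` that moves
most of the mass of each partition function into a set displaced by `F`, and barely moves `f`. -/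
lemma IsBoundary.exists_global_average {H : Subgroup Γ} {π : Y → X} (hHY : IsBoundary H π)
    (hfree : IsTopologicallyFree Γ Y) (F : Finset Γ) (hF : ∀ t ∈ F, t ≠ 1) (f : C(X, ℂ))
    {ε : ℝ} (hε : 0 < ε) :
    ∃ (m : ℕ) (s : Fin m → H) (h : Fin m → C(X, ℝ)) (χ : Fin m → C(Y, ℝ)),
      (∀ i x, 0 ≤ h i x) ∧ (∀ x, ∑ i, h i x ^ 2 = 1) ∧ (∀ i y, 0 ≤ χ i y ∧ χ i y ≤ 1) ∧
      (∀ i, ∀ t ∈ F, ∀ y, χ i y * χ i (t⁻¹ • y) = 0) ∧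
      (∀ y, ∑ i, h i (π y) ^ 2 * (1 - χ i ((s i)⁻¹ • y)) ≤ ε) ∧
      ∀ x, ‖∑ i, (h i x : ℂ) ^ 2 * f ((s i)⁻¹ • x) - f x‖ ≤ ε := by
  choose n c s χ V hV hc hc1 hχ hχF hmass hmove using hHY.exists_local_average hfree F hF f hε
  obtain ⟨T, k, hk0, hk1, hkV⟩ := exists_quadratic_partition V hV
  let e := (Fintype.equivFin (Σ i : T, Fin (n i))).symm
  have key : ∀ {E : Type} [AddCommMonoid E] (φ : (i : T) → Fin (n i) → E),
      ∑ p, φ (e p).1 (e p).2 = ∑ i, ∑ j, φ i j := fun φ => by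
    rw [e.sum_comp fun q => φ q.1 q.2, Fintype.sum_sigma]
  have hsq : ∀ (i : T) (j : Fin (n i)) x, (√(c i j) * k i x) ^ 2 = k i x ^ 2 * c i j := fun i j x => by
    rw [mul_pow, Real.sq_sqrt (hc i j), mul_comm]
  refine ⟨_, fun p => s (e p).1 (e p).2, fun p => √(c (e p).1 (e p).2) • k (e p).1,
    fun p => χ (e p).1, fun p x => mul_nonneg (Real.sqrt_nonneg _) (hk0 _ _), fun x => ?_,
    fun p => hχ _, fun p => hχF _, fun y => ?_, fun x => ?_⟩
  · simp only [ContinuousMap.smul_apply, smul_eq_mul, hsq]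
    rw [key fun i j => k i x ^ 2 * c i j]
    simp only [← Finset.mul_sum, hc1, mul_one, hk1]
  · simp only [ContinuousMap.smul_apply, smul_eq_mul, hsq]
    rw [key fun i j => k i (π y) ^ 2 * c i j * (1 - χ i ((s i j)⁻¹ • y))]
    calc _ = ∑ i, k i (π y) ^ 2 * ∑ j, c i j * (1 - χ i ((s i j)⁻¹ • y)) := by
          simp only [Finset.mul_sum, mul_assoc]
      _ ≤ ∑ i, k i (π y) ^ 2 * ε := by
          refine Finset.sum_le_sum fun i _ => ?_
          by_cases h0 : k i (π y) = 0
          · simp [h0]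
          · exact mul_le_mul_of_nonneg_left (hmass i y (hkV i _ h0)) (sq_nonneg _)
      _ = ε := by rw [← Finset.sum_mul, hk1, one_mul]
  · simp only [ContinuousMap.smul_apply, smul_eq_mul, ← Complex.ofReal_pow, hsq]
    rw [key fun i j => ((k i x ^ 2 * c i j : ℝ) : ℂ) * f ((s i j)⁻¹ • x)]
    have hf : f x = ∑ i, ((k i x ^ 2 : ℝ) : ℂ) * f x := by
      rw [← Finset.sum_mul, ← Complex.ofReal_sum, hk1, Complex.ofReal_one, one_mul]
    calc _ = ‖∑ i, ((k i x ^ 2 : ℝ) : ℂ) * (∑ j, (c i j : ℂ) * f ((s i j)⁻¹ • x) - f x)‖ := by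
          conv_lhs => rw [hf]
          simp only [mul_sub, Finset.sum_sub_distrib, Finset.mul_sum, Complex.ofReal_mul, mul_assoc]
      _ ≤ ∑ i, k i x ^ 2 * ε := by
          refine norm_sum_le_of_le _ fun i _ => ?_
          rw [norm_mul, Complex.norm_real, Real.norm_of_nonneg (sq_nonneg _)]
          by_cases h0 : k i x = 0
          · simp [h0]
          · exact mul_le_mul_of_nonneg_left (hmove i x (hkV i _ h0)) (sq_nonneg _)
      _ = ε := by rw [← Finset.sum_mul, hk1, one_mul]

end Averaging

section RowColumn

variable {E : Type*} [NormedAddCommGroup E] [InnerProductSpace ℂ E] [CompleteSpace E]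

/-- Cauchy–Schwarz for sums `∑ Lᵢ* Tᵢ Kᵢ` with bounded columns `K`, `L`. -/
lemma norm_sum_star_mul_mul_le {ι : Type*} [Fintype ι] (L T K : ι → E →L[ℂ] E) {A B M : ℝ}
    (hA : 0 ≤ A) (hB : 0 ≤ B) (hM : 0 ≤ M) (hL : ∀ ξ, ∑ i, ‖L i ξ‖ ^ 2 ≤ A ^ 2 * ‖ξ‖ ^ 2)
    (hT : ∀ i, ‖T i‖ ≤ M) (hK : ∀ ξ, ∑ i, ‖K i ξ‖ ^ 2 ≤ B ^ 2 * ‖ξ‖ ^ 2) :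
    ‖∑ i, star (L i) * T i * K i‖ ≤ A * M * B := by
  refine ContinuousLinearMap.opNorm_le_of_re_inner_le (by positivity) fun ξ η hξ hη => ?_
  have hterm : ∀ i, RCLike.re (inner ℂ ((star (L i) * T i * K i) ξ) η) ≤
      M * (‖K i ξ‖ * ‖L i η‖) := fun i => by
    change RCLike.re (inner ℂ ((ContinuousLinearMap.adjoint (L i)) (T i (K i ξ))) η) ≤ _
    rw [ContinuousLinearMap.adjoint_inner_left]
    calc _ ≤ ‖T i (K i ξ)‖ * ‖L i η‖ := re_inner_le_norm _ _
      _ ≤ (M * ‖K i ξ‖) * ‖L i η‖ := by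
        gcongr
        exact (T i).le_of_opNorm_le (hT i) _
      _ = _ := by ring
  calc RCLike.re (inner ℂ ((∑ i, star (L i) * T i * K i) ξ) η)
      = ∑ i, RCLike.re (inner ℂ ((star (L i) * T i * K i) ξ) η) := by
        rw [sum_apply, sum_inner, map_sum]
    _ ≤ M * ∑ i, ‖K i ξ‖ * ‖L i η‖ := by
        rw [Finset.mul_sum]
        exact Finset.sum_le_sum fun i _ => hterm i
    _ ≤ M * (√(∑ i, ‖K i ξ‖ ^ 2) * √(∑ i, ‖L i η‖ ^ 2)) := by
        gcongr
        exact Real.sum_mul_le_sqrt_mul_sqrt _ _ _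
    _ ≤ M * (B * A) := by
        have h1 := hK ξ
        have h2 := hL η
        rw [hξ, one_pow, mul_one] at h1
        rw [hη, one_pow, mul_one] at h2
        gcongr
        · exact Real.sqrt_le_iff.2 ⟨hB, h1⟩
        · exact Real.sqrt_le_iff.2 ⟨hA, h2⟩
    _ = A * M * B := by ring

/-- A row of functions with pointwise square sum at most `A ^ 2` acts as a bounded column. -/
lemma sum_norm_sq_rep_le {Z : Type*} [TopologicalSpace Z] [CompactSpace Z]
    (θ : C(Z, ℂ) →⋆ₐ[ℂ] (E →L[ℂ] E)) {ι : Type*} [Fintype ι] (u : ι → C(Z, ℂ)) {A : ℝ}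
    (hu : ∀ z, ∑ i, ‖u i z‖ ^ 2 ≤ A ^ 2) (ξ : E) :
    ∑ i, ‖θ (u i) ξ‖ ^ 2 ≤ A ^ 2 * ‖ξ‖ ^ 2 := by
  have hi : ∀ i, ‖θ (u i) ξ‖ ^ 2 = RCLike.re (inner ℂ (θ (star (u i) * u i) ξ) ξ) := fun i => by
    rw [map_mul, map_star]
    change _ = RCLike.re (inner ℂ ((ContinuousLinearMap.adjoint (θ (u i))) (θ (u i) ξ)) ξ)
    rw [ContinuousLinearMap.adjoint_inner_left, inner_self_eq_norm_sq]
  have hw : ‖∑ i, star (u i) * u i‖ ≤ A ^ 2 := by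
    refine (ContinuousMap.norm_le _ (sq_nonneg A)).2 fun z => ?_
    rw [ContinuousMap.coe_sum, Finset.sum_apply]
    refine le_trans (norm_sum_le _ _) (le_trans (Finset.sum_le_sum fun i _ => ?_) (hu z))
    simp [sq]
  calc ∑ i, ‖θ (u i) ξ‖ ^ 2 = RCLike.re (inner ℂ (θ (∑ i, star (u i) * u i) ξ) ξ) := by
        simp only [hi, map_sum, sum_apply, sum_inner]
    _ ≤ ‖θ (∑ i, star (u i) * u i) ξ‖ * ‖ξ‖ := re_inner_le_norm _ _
    _ ≤ (A ^ 2 * ‖ξ‖) * ‖ξ‖ := by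
        gcongr
        exact ContinuousLinearMap.le_of_opNorm_le _
          ((NonUnitalStarAlgHom.norm_apply_le θ _).trans hw) _
    _ = A ^ 2 * ‖ξ‖ ^ 2 := by ring

end RowColumn

section Covariance

variable {Γ : Type*} [Group Γ]
variable {𝓗 : Type*} [NormedAddCommGroup 𝓗] [InnerProductSpace ℂ 𝓗]

lemma shift_mul_shift (s t : Γ) : shift 𝓗 s * shift 𝓗 t = shift 𝓗 (s * t) := by
  ext ξ r
  simp [mul_assoc]

lemma shift_one : shift 𝓗 (1 : Γ) = 1 := by
  ext ξ r
  simp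

lemma norm_shift_apply (s : Γ) (ξ : L2 Γ 𝓗) : ‖shift 𝓗 s ξ‖ = ‖ξ‖ := by
  have h : ∀ (t : Γ) (η : L2 Γ 𝓗), ‖shift 𝓗 t η‖ ≤ ‖η‖ := fun t η => by
    refine ((shift 𝓗 t).le_of_opNorm_le (LinearMap.mkContinuous_norm_le _ zero_le_one _) η).trans ?_
    rw [one_mul]
  refine le_antisymm (h s ξ) ?_
  have h2 := h s⁻¹ (shift 𝓗 s ξ)
  rwa [← mul_apply_eq_comp, shift_mul_shift, inv_mul_cancel, shift_one, one_apply_eq_self] at h2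

lemma norm_shift_le (s : Γ) : ‖shift 𝓗 s‖ ≤ 1 := LinearMap.mkContinuous_norm_le _ zero_le_one _

variable [CompleteSpace 𝓗]

lemma star_shift (s : Γ) : star (shift 𝓗 s) = shift 𝓗 s⁻¹ := by
  rw [ContinuousLinearMap.star_eq_adjoint, eq_comm, ContinuousLinearMap.eq_adjoint_iff]
  intro ξ η
  rw [lp.inner_eq_tsum, lp.inner_eq_tsum,
    ← (Equiv.mulLeft s).tsum_eq fun r => inner ℂ (ξ r) (shift 𝓗 s η r)]
  simp

variable {X : Type*} [TopologicalSpace X] [CompactSpace X] [MulAction Γ X]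
  [ContinuousConstSMul Γ X]

lemma act_act (s t : Γ) (f : C(X, ℂ)) : act s (act t f) = act (s * t) f := by
  ext x
  simp [mul_smul]

variable (ρ : C(X, ℂ) →⋆ₐ[ℂ] (𝓗 →L[ℂ] 𝓗))

lemma norm_sigma_le (f : C(X, ℂ)) : ‖sigma Γ ρ f‖ ≤ ‖f‖ :=
  LinearMap.mkContinuous_norm_le _ (norm_nonneg f) _

lemma shift_mul_sigma (s : Γ) (f : C(X, ℂ)) :
    shift 𝓗 s * sigma Γ ρ f = sigma Γ ρ (act s f) * shift 𝓗 s := by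
  ext ξ r
  simp [act_act]

variable (Γ) in
/-- The representation `σ` of `C(X)` on `ℓ²(Γ, 𝓗)`, as a `*`-homomorphism. -/
def sigmaHom : C(X, ℂ) →⋆ₐ[ℂ] (L2 Γ 𝓗 →L[ℂ] L2 Γ 𝓗) where
  toFun := sigma Γ ρ
  map_one' := by
    ext ξ r
    have : act r⁻¹ (1 : C(X, ℂ)) = 1 := rfl
    simp [this]
  map_mul' f g := by
    ext ξ r
    have : act r⁻¹ (f * g) = act r⁻¹ f * act r⁻¹ g := rfl
    simp [this]
  map_zero' := by
    ext ξ r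
    have : act r⁻¹ (0 : C(X, ℂ)) = 0 := rfl
    simp [this]
  map_add' f g := by
    ext ξ r
    have : act r⁻¹ (f + g) = act r⁻¹ f + act r⁻¹ g := rfl
    simp [this]
  commutes' c := by
    ext ξ r
    have : act r⁻¹ (algebraMap ℂ C(X, ℂ) c) = algebraMap ℂ C(X, ℂ) c := rfl
    rw [sigma_apply, this, AlgHomClass.commutes]
    rfl
  map_star' f := by
    rw [ContinuousLinearMap.star_eq_adjoint, ContinuousLinearMap.eq_adjoint_iff]
    intro ξ η
    rw [lp.inner_eq_tsum, lp.inner_eq_tsum]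
    refine tsum_congr fun r => ?_
    have : act r⁻¹ (star f) = star (act r⁻¹ f) := rfl
    rw [sigma_apply, sigma_apply, this, map_star, ContinuousLinearMap.star_eq_adjoint,
      ContinuousLinearMap.adjoint_inner_left]

lemma sigma_mul (f g : C(X, ℂ)) : sigma Γ ρ (f * g) = sigma Γ ρ f * sigma Γ ρ g :=
  map_mul (sigmaHom Γ ρ) f g

lemma sigma_add (f g : C(X, ℂ)) : sigma Γ ρ (f + g) = sigma Γ ρ f + sigma Γ ρ g :=
  map_add (sigmaHom Γ ρ) f g

lemma sigma_sub (f g : C(X, ℂ)) : sigma Γ ρ (f - g) = sigma Γ ρ f - sigma Γ ρ g :=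
  map_sub (sigmaHom Γ ρ) f g

lemma sigma_zero : sigma Γ ρ (0 : C(X, ℂ)) = 0 := map_zero (sigmaHom Γ ρ)

lemma sigma_one : sigma Γ ρ (1 : C(X, ℂ)) = 1 := map_one (sigmaHom Γ ρ)

lemma sigma_sum {ι : Type*} (S : Finset ι) (f : ι → C(X, ℂ)) :
    sigma Γ ρ (∑ i ∈ S, f i) = ∑ i ∈ S, sigma Γ ρ (f i) :=
  map_sum (sigmaHom Γ ρ) f S

lemma sigma_smul (c : ℂ) (f : C(X, ℂ)) : sigma Γ ρ (c • f) = c • sigma Γ ρ f :=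
  map_smul (sigmaHom Γ ρ) c f

lemma star_sigma (f : C(X, ℂ)) : star (sigma Γ ρ f) = sigma Γ ρ (star f) :=
  (map_star (sigmaHom Γ ρ) f).symm

variable (Γ) in
/-- The diagonal amplification of a representation to `ℓ²(Γ, 𝓗)`. -/
def diagonalHom : C(X, ℂ) →⋆ₐ[ℂ] (L2 Γ 𝓗 →L[ℂ] L2 Γ 𝓗) where
  toFun f := lp.mapCLM 2 (fun _ : Γ => ρ f) (norm_nonneg f)
    fun _ => NonUnitalStarAlgHom.norm_apply_le ρ f
  map_one' := by ext ξ r; simp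
  map_mul' f g := by ext ξ r; simp
  map_zero' := by ext ξ r; simp
  map_add' f g := by ext ξ r; simp
  commutes' c := by
    ext ξ r
    rw [lp.mapCLM_apply_coe, AlgHomClass.commutes]
    rfl
  map_star' f := by
    rw [ContinuousLinearMap.star_eq_adjoint, ContinuousLinearMap.eq_adjoint_iff]
    intro ξ η
    rw [lp.inner_eq_tsum, lp.inner_eq_tsum]
    refine tsum_congr fun r => ?_
    rw [lp.mapCLM_apply_coe, lp.mapCLM_apply_coe, map_star, ContinuousLinearMap.star_eq_adjoint,
      ContinuousLinearMap.adjoint_inner_left]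

@[simp] lemma diagonalHom_apply (f : C(X, ℂ)) (ξ : L2 Γ 𝓗) (r : Γ) :
    diagonalHom Γ ρ f ξ r = ρ f (ξ r) := rfl

end Covariance

section Transfer

/-- A real-valued continuous function as a complex-valued one. -/
def ofRealMap {X : Type*} [TopologicalSpace X] (f : C(X, ℝ)) : C(X, ℂ) :=
  ⟨fun x => (f x : ℂ), by fun_prop⟩

@[simp] lemma ofRealMap_apply {X : Type*} [TopologicalSpace X] (f : C(X, ℝ)) (x : X) :
    ofRealMap f x = (f x : ℂ) := rfl

lemma star_ofRealMap {X : Type*} [TopologicalSpace X] (f : C(X, ℝ)) :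
    star (ofRealMap f) = ofRealMap f := by
  ext x
  simp

variable (𝓗 : Type*) [NormedAddCommGroup 𝓗] [InnerProductSpace ℂ 𝓗] [CompleteSpace 𝓗]

/-- Evaluation at a point, as a representation by scalars on `𝓗`. -/
def evalRep {X : Type*} [TopologicalSpace X] (x : X) : C(X, ℂ) →⋆ₐ[ℂ] (𝓗 →L[ℂ] 𝓗) :=
  (StarAlgHom.ofId ℂ (𝓗 →L[ℂ] 𝓗)).comp (ContinuousMap.evalStarAlgHom ℂ ℂ x)

variable {𝓗}

@[simp] lemma evalRep_apply {X : Type*} [TopologicalSpace X] (x : X) (f : C(X, ℂ)) (v : 𝓗) :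
    evalRep 𝓗 x f v = f x • v := rfl

variable {Γ : Type*} [Group Γ]
variable {X : Type*} [TopologicalSpace X] [CompactSpace X] [T2Space X] [MulAction Γ X]
  [ContinuousConstSMul Γ X] (ρ : C(X, ℂ) →⋆ₐ[ℂ] (𝓗 →L[ℂ] 𝓗))

lemma sum_sigma_mul_shift_apply {ι : Type*} [Fintype ι] (F : ι → C(X, ℂ)) (t : ι → Γ)
    (ξ : L2 Γ 𝓗) (r : Γ) : (∑ i, sigma Γ ρ (F i) * shift 𝓗 (t i)) ξ r =
      ∑ i, ρ (act r⁻¹ (F i)) (ξ ((t i)⁻¹ * r)) := by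
  rw [sum_apply, lp.coeFn_sum, Finset.sum_apply]
  rfl

/-- The norm of an element of the algebraic crossed product in the representation induced by `ρ` is
dominated by its norms in the representations induced by the points of `X`. -/
lemma norm_sum_sigma_mul_shift_le {ι : Type*} [Fintype ι] (F : ι → C(X, ℂ)) (t : ι → Γ) {C : ℝ}
    (hC : 0 ≤ C)
    (h : ∀ x : X, ‖∑ i, sigma Γ (evalRep 𝓗 x) (F i) * shift 𝓗 (t i)‖ ≤ C) :
    ‖∑ i, sigma Γ ρ (F i) * shift 𝓗 (t i)‖ ≤ C := by
  classical
  refine ContinuousLinearMap.opNorm_le_bound _ hC fun ξ => ?_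
  have happrox : ∀ (R : Finset Γ) (δ : ℝ), 0 < δ → ∃ ζ : L2 Γ 𝓗, ‖ζ‖ ≤ C * ‖ξ‖ ∧
      ∀ r ∈ R, ‖ζ r - (∑ i, sigma Γ ρ (F i) * shift 𝓗 (t i)) ξ r‖ ≤ δ := by
    intro R δ hδ
    obtain ⟨δ', hδ', hδ''⟩ : ∃ δ' : ℝ, 0 < δ' ∧ (Fintype.card ι) * (δ' * ‖ξ‖) ≤ δ := by
      refine ⟨δ / (Fintype.card ι * ‖ξ‖ + 1), by positivity, ?_⟩
      rw [div_mul_eq_mul_div, mul_div_assoc', div_le_iff₀ (by positivity)]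
      nlinarith
    obtain ⟨S, k, -, hk1, hkV⟩ := exists_quadratic_partition
      (fun x => {z | ∀ r ∈ R, ∀ i, ‖F i (r • x) - F i (r • z)‖ < δ'}) (fun x => by
        refine (Filter.eventually_all_finset R).2 fun r _ => Filter.eventually_all.2 fun i => ?_
        have hr : Continuous fun z : X => r • z := continuous_const_smul r
        exact (isOpen_lt (by fun_prop) continuous_const).mem_nhds (by simpa using hδ'))
    have hD : ∀ η : L2 Γ 𝓗, ∑ l, ‖diagonalHom Γ ρ (ofRealMap (k l)) η‖ ^ 2 ≤ 1 ^ 2 * ‖η‖ ^ 2 :=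
      sum_norm_sq_rep_le _ _ fun z => by simpa using (hk1 z).le
    refine ⟨(∑ l : S, star (diagonalHom Γ ρ (ofRealMap (k l))) *
      (∑ i, sigma Γ (evalRep 𝓗 (l : X)) (F i) * shift 𝓗 (t i)) *
        diagonalHom Γ ρ (ofRealMap (k l))) ξ, ?_, fun r hr => ?_⟩
    · refine ContinuousLinearMap.le_of_opNorm_le _ ?_ ξ
      simpa using norm_sum_star_mul_mul_le _ _ _ zero_le_one zero_le_one hC hD (fun l => h l) hD
    · have hζ : (∑ l : S, star (diagonalHom Γ ρ (ofRealMap (k l))) *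
          (∑ i, sigma Γ (evalRep 𝓗 (l : X)) (F i) * shift 𝓗 (t i)) *
          diagonalHom Γ ρ (ofRealMap (k l))) ξ r =
          ∑ i, ρ (∑ l : S, F i (r • (l : X)) • (ofRealMap (k l) * ofRealMap (k l)))
            (ξ ((t i)⁻¹ * r)) := by
        rw [sum_apply, lp.coeFn_sum, Finset.sum_apply]
        simp only [map_sum, sum_apply]
        rw [Finset.sum_comm]
        refine Finset.sum_congr rfl fun l _ => ?_
        rw [← map_star, star_ofRealMap, mul_apply_eq_comp, mul_apply_eq_comp, diagonalHom_apply,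
          sum_sigma_mul_shift_apply, map_sum]
        refine Finset.sum_congr rfl fun i _ => ?_
        simp
      rw [hζ, sum_sigma_mul_shift_apply, ← Finset.sum_sub_distrib]
      refine le_trans (norm_sum_le_of_le (n := fun _ => δ' * ‖ξ‖) _ fun i _ => ?_)
        (by simpa using hδ'')
      rw [← sub_apply, ← map_sub]
      refine ((ρ _).le_of_opNorm_le (c := δ') ?_ _).trans
        (mul_le_mul_of_nonneg_left (lp.norm_apply_le_norm two_ne_zero ξ _) hδ'.le)
      refine (NonUnitalStarAlgHom.norm_apply_le ρ _).trans
        ((ContinuousMap.norm_le _ hδ'.le).2 fun z => ?_)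
      have hF : act r⁻¹ (F i) z = ∑ l, ((k l z ^ 2 : ℝ) : ℂ) * F i (r • z) := by
        rw [← Finset.sum_mul, ← Complex.ofReal_sum, hk1]
        simp
      rw [ContinuousMap.sub_apply, hF, ContinuousMap.coe_sum, Finset.sum_apply,
        ← Finset.sum_sub_distrib]
      calc _ ≤ ∑ l, k l z ^ 2 * δ' := norm_sum_le_of_le _ fun l _ => by
            have : (F i (r • (l : X)) • (ofRealMap (k l) * ofRealMap (k l))) z -
                ((k l z ^ 2 : ℝ) : ℂ) * F i (r • z) =
                ((k l z ^ 2 : ℝ) : ℂ) * (F i (r • (l : X)) - F i (r • z)) := by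
              simp
              ring
            rw [this, norm_mul, Complex.norm_real, Real.norm_of_nonneg (sq_nonneg _)]
            by_cases h0 : k l z = 0
            · simp [h0]
            · exact mul_le_mul_of_nonneg_left (hkV l z h0 r hr i).le (sq_nonneg _)
        _ = δ' := by rw [← Finset.sum_mul, hk1, one_mul]
  choose ζ hζ hζR using fun p : Finset Γ × ℕ => happrox p.1 (1 / ((p.2 : ℝ) + 1)) (by positivity)
  refine lp.norm_le_of_tendsto (l := (Filter.atTop : Filter (Finset Γ × ℕ))) (F := ζ)
    (Filter.Eventually.of_forall hζ)
    (tendsto_pi_nhds.2 fun r => ?_)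
  refine tendsto_iff_norm_sub_tendsto_zero.2 (squeeze_zero' (g := fun p => 1 / ((p.2 : ℝ) + 1))
    (Filter.Eventually.of_forall fun _ => norm_nonneg _) ?_ ?_)
  · filter_upwards [Filter.eventually_ge_atTop (({r} : Finset Γ), 0)] with p hp
    exact hζR p r (hp.1 (Finset.mem_singleton_self r))
  · rw [← Filter.prod_atTop_atTop_eq]
    exact tendsto_one_div_add_atTop_nhds_zero_nat.comp Filter.tendsto_snd

end Transfer

section AverageMap

variable {Γ : Type*} [Group Γ]
variable {𝓗 : Type*} [NormedAddCommGroup 𝓗] [InnerProductSpace ℂ 𝓗] [CompleteSpace 𝓗]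
variable {Z : Type*} [TopologicalSpace Z] [CompactSpace Z] [MulAction Γ Z]
  [ContinuousConstSMul Γ Z] (θ : C(Z, ℂ) →⋆ₐ[ℂ] (𝓗 →L[ℂ] 𝓗))
variable {ι : Type*} [Fintype ι]

/-- The averaging map `T ↦ ∑ⱼ gⱼ λ(sⱼ) T λ(sⱼ)* gⱼ`. -/
def average (s : ι → Γ) (g : ι → C(Z, ℂ)) :
    (L2 Γ 𝓗 →L[ℂ] L2 Γ 𝓗) →+ (L2 Γ 𝓗 →L[ℂ] L2 Γ 𝓗) where
  toFun T := ∑ j, sigma Γ θ (g j) * shift 𝓗 (s j) * T * star (shift 𝓗 (s j)) * sigma Γ θ (g j)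
  map_zero' := by simp
  map_add' S T := by simp only [mul_add, add_mul, Finset.sum_add_distrib]

lemma average_apply (s : ι → Γ) (g : ι → C(Z, ℂ)) (T : L2 Γ 𝓗 →L[ℂ] L2 Γ 𝓗) :
    average θ s g T =
      ∑ j, sigma Γ θ (g j) * shift 𝓗 (s j) * T * star (shift 𝓗 (s j)) * sigma Γ θ (g j) := rfl

lemma sum_norm_sq_shift_sigma_le (s : ι → Γ) (u : ι → C(Z, ℂ)) {A : ℝ}
    (hu : ∀ z, ∑ i, ‖u i z‖ ^ 2 ≤ A ^ 2) (ξ : L2 Γ 𝓗) :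
    ∑ i, ‖(star (shift 𝓗 (s i)) * sigma Γ θ (u i)) ξ‖ ^ 2 ≤ A ^ 2 * ‖ξ‖ ^ 2 := by
  simp only [star_shift, mul_apply_eq_comp, norm_shift_apply]
  exact sum_norm_sq_rep_le (sigmaHom Γ θ) u hu ξ

lemma star_shift_sigma (s : Γ) (h : C(Z, ℝ)) :
    star (star (shift 𝓗 s) * sigma Γ θ (ofRealMap h)) =
      sigma Γ θ (ofRealMap h) * shift 𝓗 s := by
  rw [star_mul, star_star, star_sigma, star_ofRealMap]

lemma norm_average_le (s : ι → Γ) (h : ι → C(Z, ℝ)) (hh : ∀ z, ∑ i, h i z ^ 2 = 1)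
    (T : L2 Γ 𝓗 →L[ℂ] L2 Γ 𝓗) : ‖average θ s (fun i => ofRealMap (h i)) T‖ ≤ ‖T‖ := by
  have hK := sum_norm_sq_shift_sigma_le (𝓗 := 𝓗) θ s (fun i => ofRealMap (h i)) (A := 1)
    fun z => by simp [hh]
  have := norm_sum_star_mul_mul_le _ (fun _ => T) _ zero_le_one zero_le_one (norm_nonneg T) hK
    (fun _ => le_rfl) hK
  rw [one_mul, mul_one] at this
  rw [average_apply]
  simpa only [star_shift_sigma, mul_assoc] using this

/-- The average of a monomial `σ(f) λ(t)` is small when most of the mass of the partition is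
supported on sets that `t` displaces. -/
lemma norm_average_monomial_le (s : ι → Γ) (h χ : ι → C(Z, ℝ)) (hh : ∀ z, ∑ i, h i z ^ 2 = 1)
    (hχ : ∀ i z, 0 ≤ χ i z ∧ χ i z ≤ 1) {t : Γ} (hχt : ∀ i z, χ i z * χ i (t⁻¹ • z) = 0)
    {δ : ℝ} (hδ : 0 ≤ δ) (hmass : ∀ z, ∑ i, h i z ^ 2 * (1 - χ i ((s i)⁻¹ • z)) ≤ δ ^ 2)
    (f : C(Z, ℂ)) :
    ‖average θ s (fun i => ofRealMap (h i)) (sigma Γ θ f * shift 𝓗 t)‖ ≤ 2 * δ * ‖f‖ := by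
  set b := sigma Γ θ f * shift 𝓗 t with hb
  let p : ι → L2 Γ 𝓗 →L[ℂ] L2 Γ 𝓗 := fun i => sigma Γ θ (ofRealMap (χ i))
  let q : ι → L2 Γ 𝓗 →L[ℂ] L2 Γ 𝓗 := fun i => sigma Γ θ (ofRealMap (1 - χ i))
  let K : ι → L2 Γ 𝓗 →L[ℂ] L2 Γ 𝓗 := fun i => star (shift 𝓗 (s i)) * sigma Γ θ (ofRealMap (h i))
  have hpq : ∀ i, p i + q i = 1 := fun i => by
    rw [← sigma_add, ← sigma_one (Γ := Γ) θ]
    congr 1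
    ext z
    simp
  have hpbp : ∀ i, p i * b * p i = 0 := fun i => by
    have h0 : ofRealMap (χ i) * f * act t (ofRealMap (χ i)) = 0 := by
      ext z
      have := hχt i z
      simp only [ContinuousMap.mul_apply, ofRealMap_apply, act_apply, ContinuousMap.zero_apply]
      rw [mul_right_comm, ← Complex.ofReal_mul, this]
      simp
    simp only [p, hb]
    rw [← mul_assoc, mul_assoc, shift_mul_sigma, ← mul_assoc, ← sigma_mul, ← sigma_mul, h0,
      sigma_zero, zero_mul]
  have hbb : ∀ i, b = q i * b + p i * b * q i := fun i => by
    have h1 : p i * b = p i * b * q i := by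
      conv_lhs => rw [← mul_one (p i * b), ← hpq i, mul_add, hpbp, zero_add]
    rw [← h1, ← add_mul, add_comm, hpq, one_mul]
  have hb_norm : ‖b‖ ≤ ‖f‖ := (norm_mul_le _ _).trans <|
    (mul_le_mul (norm_sigma_le θ f) (norm_shift_le t) (norm_nonneg _) (norm_nonneg _)).trans
      (mul_one _).le
  have hp_norm : ∀ i, ‖p i‖ ≤ 1 := fun i => (norm_sigma_le θ _).trans <|
    (ContinuousMap.norm_le _ zero_le_one).2 fun z => by
      rw [ofRealMap_apply, Complex.norm_real, Real.norm_of_nonneg (hχ i z).1]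
      exact (hχ i z).2
  have hpb_norm : ∀ i, ‖p i * b‖ ≤ ‖f‖ := fun i => (norm_mul_le _ _).trans <|
    (mul_le_mul (hp_norm i) hb_norm (norm_nonneg _) zero_le_one).trans (one_mul _).le
  have hK : ∀ ξ, ∑ i, ‖K i ξ‖ ^ 2 ≤ 1 ^ 2 * ‖ξ‖ ^ 2 :=
    sum_norm_sq_shift_sigma_le θ s _ fun z => by simp [hh]
  have hqK : ∀ i, q i * K i = star (shift 𝓗 (s i)) *
      sigma Γ θ (act (s i) (ofRealMap (1 - χ i)) * ofRealMap (h i)) := fun i => by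
    simp only [q, K, star_shift]
    rw [sigma_mul, ← mul_assoc, ← mul_assoc, shift_mul_sigma, act_act, inv_mul_cancel, act_one]
  have hqKsq : ∀ ξ, ∑ i, ‖(q i * K i) ξ‖ ^ 2 ≤ δ ^ 2 * ‖ξ‖ ^ 2 := by
    simp only [hqK]
    refine sum_norm_sq_shift_sigma_le θ s _ fun z => le_trans (Finset.sum_le_sum fun i _ => ?_)
      (hmass z)
    obtain ⟨h0, h1⟩ := hχ i ((s i)⁻¹ • z)
    rw [ContinuousMap.mul_apply, act_apply, ofRealMap_apply, ofRealMap_apply, norm_mul,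
      Complex.norm_real, Complex.norm_real, mul_pow, Real.norm_eq_abs, Real.norm_eq_abs, sq_abs,
      sq_abs, ContinuousMap.sub_apply, ContinuousMap.one_apply, mul_comm]
    exact mul_le_mul_of_nonneg_left (by nlinarith) (sq_nonneg _)
  have hstarq : ∀ i, star (q i) = q i := fun i => by
    simp only [q]
    rw [star_sigma, star_ofRealMap]
  have hsplit : average θ s (fun i => ofRealMap (h i)) b =
      ∑ i, star (q i * K i) * b * K i + ∑ i, star (K i) * (p i * b) * (q i * K i) := by
    rw [average_apply, ← Finset.sum_add_distrib]
    refine Finset.sum_congr rfl fun i _ => ?_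
    conv_lhs => rw [hbb i]
    rw [star_mul, hstarq]
    simp only [K]
    rw [star_shift_sigma]
    noncomm_ring
  rw [hsplit]
  refine (norm_add_le _ _).trans ?_
  have h1 := norm_sum_star_mul_mul_le _ (fun _ => b) _ hδ zero_le_one (norm_nonneg f) hqKsq
    (fun _ => hb_norm) hK
  have h2 := norm_sum_star_mul_mul_le _ _ _ zero_le_one hδ (norm_nonneg f) hK hpb_norm hqKsq
  linarith

lemma average_monomial (s : ι → Γ) (g : ι → C(Z, ℂ)) (f : C(Z, ℂ)) (t : Γ) :
    average θ s g (sigma Γ θ f * shift 𝓗 t) =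
      ∑ j, sigma Γ θ (g j * act (s j) f * act (s j * t * (s j)⁻¹) (g j)) *
        shift 𝓗 (s j * t * (s j)⁻¹) := by
  rw [average_apply]
  refine Finset.sum_congr rfl fun j _ => ?_
  rw [star_shift, sigma_mul, sigma_mul, mul_assoc _ (sigma Γ θ (act _ (g j))), ← shift_mul_sigma,
    ← shift_mul_shift, ← shift_mul_shift]
  have := shift_mul_sigma θ (s j) f
  simp only [← mul_assoc]
  rw [mul_assoc _ (shift 𝓗 (s j)) (sigma Γ θ f), this]
  simp only [mul_assoc]

lemma average_sigma (s : ι → Γ) (g : ι → C(Z, ℂ)) (f : C(Z, ℂ)) :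
    average θ s g (sigma Γ θ f) = sigma Γ θ (∑ j, g j ^ 2 * act (s j) f) := by
  have h := average_monomial θ s g f (1 : Γ)
  simp only [shift_one, mul_one, mul_inv_cancel, act_one] at h
  rw [h, sigma_sum]
  refine Finset.sum_congr rfl fun j _ => ?_
  congr 1
  ring

/-- The monomial estimate on `X`, with displaced sets in an extension `Y` of `X`. -/
lemma norm_average_monomial_le_of_isFactorMap [T2Space Z] {Y : Type*} [TopologicalSpace Y]
    [CompactSpace Y] [MulAction Γ Y] [ContinuousConstSMul Γ Y] {π : Y → Z} (hπ : IsFactorMap Γ π)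
    (s : ι → Γ) (h : ι → C(Z, ℝ)) (χ : ι → C(Y, ℝ)) (hh : ∀ z, ∑ i, h i z ^ 2 = 1)
    (hχ : ∀ i y, 0 ≤ χ i y ∧ χ i y ≤ 1) {t : Γ} (hχt : ∀ i y, χ i y * χ i (t⁻¹ • y) = 0)
    {δ : ℝ} (hδ : 0 ≤ δ)
    (hmass : ∀ y, ∑ i, h i (π y) ^ 2 * (1 - χ i ((s i)⁻¹ • y)) ≤ δ ^ 2) (f : C(Z, ℂ)) :
    ‖average θ s (fun i => ofRealMap (h i)) (sigma Γ θ f * shift 𝓗 t)‖ ≤ 2 * δ * ‖f‖ := by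
  let P : C(Y, Z) := ⟨π, hπ.continuous⟩
  have hP : ∀ (g : Γ) (k : C(Z, ℂ)), (act g k).comp P = act g (k.comp P) := fun g k => by
    ext y
    simp [P, hπ.map_smul]
  rw [average_monomial]
  refine norm_sum_sigma_mul_shift_le θ _ _ (by positivity) fun z => ?_
  obtain ⟨y, rfl⟩ := hπ.surjective z
  have hpull : ∀ k : C(Z, ℂ), sigma Γ (evalRep 𝓗 (π y)) k = sigma Γ (evalRep 𝓗 y) (k.comp P) := by
    intro k
    ext ξ r
    simp [P, hπ.map_smul]
  have hY := norm_average_monomial_le (evalRep 𝓗 y) s (fun i => (h i).comp P) χ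
    (fun y => hh (π y)) hχ hχt hδ hmass (f.comp P)
  rw [average_monomial] at hY
  refine le_trans (le_of_eq ?_) (hY.trans ?_)
  · congr 1
    refine Finset.sum_congr rfl fun i _ => ?_
    rw [hpull]
    congr 2
    rw [← hP, show ofRealMap ((h i).comp P) = (ofRealMap (h i)).comp P from rfl, ← hP]
    rfl
  · gcongr
    exact (ContinuousMap.norm_le _ (norm_nonneg f)).2 fun y => f.norm_coe_le_norm _

end AverageMap

section Approximation

variable {Γ : Type*} [Group Γ]
variable {𝓗 : Type*} [NormedAddCommGroup 𝓗] [InnerProductSpace ℂ 𝓗] [CompleteSpace 𝓗]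
variable {X : Type*} [TopologicalSpace X] [CompactSpace X] [MulAction Γ X]
  [ContinuousConstSMul Γ X] (ρ : C(X, ℂ) →⋆ₐ[ℂ] (𝓗 →L[ℂ] 𝓗))

/-- The element `σ(f) λ(t)` of the reduced crossed product. -/
def monomial (f : C(X, ℂ)) (t : Γ) : reducedCrossedProduct Γ ρ :=
  ⟨sigma Γ ρ f * shift 𝓗 t, sigma_mul_shift_mem ρ f t⟩

lemma exists_sum_monomial_near (a : reducedCrossedProduct Γ ρ) {ε : ℝ} (hε : 0 < ε) :
    ∃ (n : ℕ) (f : Fin n → C(X, ℂ)) (t : Fin n → Γ), ‖a - ∑ i, monomial ρ (f i) (t i)‖ < ε := by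
  have ha : (a : L2 Γ 𝓗 →L[ℂ] L2 Γ 𝓗) ∈ closure
      (Submodule.span ℂ {T | ∃ (f : C(X, ℂ)) (s : Γ), T = sigma Γ ρ f * shift 𝓗 s} : Set _) := a.2
  obtain ⟨b, hb, hab⟩ := Metric.mem_closure_iff.1 ha ε hε
  obtain ⟨n, c, g, rfl⟩ := Submodule.mem_span_set'.1 hb
  choose f t hft using fun i => (g i).2
  refine ⟨n, fun i => c i • f i, t, ?_⟩
  rw [dist_eq_norm] at hab
  change ‖((a - ∑ i, monomial ρ (c i • f i) (t i) : reducedCrossedProduct Γ ρ) :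
    L2 Γ 𝓗 →L[ℂ] L2 Γ 𝓗)‖ < ε
  rw [Submodule.coe_sub, Submodule.coe_sum]
  simpa only [monomial, sigma_smul, smul_mul_assoc, hft] using hab

variable {ρ} in
lemma norm_condExp_le (hρ : Function.Injective ρ) (a : reducedCrossedProduct Γ ρ) :
    ‖condExp hρ a‖ ≤ ‖a‖ := by
  classical
  rw [← NonUnitalStarAlgHom.norm_map ρ hρ, rep_condExp]
  refine ContinuousLinearMap.opNorm_le_bound _ (norm_nonneg a) fun v => ?_
  rw [compress_apply]
  refine (lp.norm_apply_le_norm two_ne_zero _ 1).trans ?_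
  refine (ContinuousLinearMap.le_opNorm _ _).trans_eq ?_
  rw [lp.norm_single (by simp)]
  rfl

end Approximation

end GammaSpace

end

open GammaSpace in
theorem mainTheorem6 {Γ : Type*} [Group Γ]
    {X : Type*} [TopologicalSpace X] [CompactSpace X] [T2Space X]
    [MulAction Γ X] [ContinuousConstSMul Γ X]
    {Y : Type*} [TopologicalSpace Y] [CompactSpace Y] [T2Space Y]
    [MeasurableSpace Y] [BorelSpace Y] [MulAction Γ Y] [ContinuousConstSMul Γ Y]
    (H : Subgroup Γ) (π : Y → X)
    (hY : GammaSpace.IsBoundary Γ π)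
    (hfree : GammaSpace.IsTopologicallyFree Γ Y)
    (hHX : MulAction.IsMinimal H X)
    (hHY : GammaSpace.IsBoundary H π)
    {𝓗 : Type*} [NormedAddCommGroup 𝓗] [InnerProductSpace ℂ 𝓗] [CompleteSpace 𝓗]
    (ρ : C(X, ℂ) →⋆ₐ[ℂ] (𝓗 →L[ℂ] 𝓗)) (hρ : Function.Injective ρ) :
    GammaSpace.IsPlump hρ H := by
  classical
  intro ε hε a
  obtain ⟨n, f, t, ha⟩ := exists_sum_monomial_near ρ a (ε := ε / 3) (by positivity)
  set a₀ := ∑ i, monomial ρ (f i) (t i) with ha₀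
  set f₀ : C(X, ℂ) := condExp hρ a₀ with hf₀
  have hf₀_eq : f₀ = ∑ i, if t i = 1 then f i else 0 := by
    rw [hf₀, ha₀, map_sum]
    exact Finset.sum_congr rfl fun i _ => condExp_sigma_mul_shift hρ (f i) (t i)
  set S : ℝ := ∑ i, ‖f i‖ with hS
  have hS0 : 0 ≤ S := Finset.sum_nonneg fun i _ => norm_nonneg _
  obtain ⟨δ, hδ, hδ1, hδS⟩ : ∃ δ : ℝ, 0 < δ ∧ δ ≤ 1 ∧ δ * (2 * S + 1) ≤ ε / 3 := by
    refine ⟨min 1 (ε / 3 / (2 * S + 1)), by positivity, min_le_left _ _, ?_⟩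
    exact (mul_le_mul_of_nonneg_right (min_le_right _ _) (by positivity)).trans
      (div_mul_cancel₀ _ (by positivity)).le
  obtain ⟨m, s, h, χ, hh0, hh1, hχ, hχF, hmass, hmove⟩ := hHY.exists_global_average hfree
    ((Finset.univ.image t).erase 1) (fun t ht => Finset.ne_of_mem_erase ht) f₀ (pow_pos hδ 2)
  set g : Fin m → C(X, ℂ) := fun i => ofRealMap (h i) with hg
  set P := average ρ (fun i => (s i : Γ)) g with hP
  refine ⟨m, fun i => s i, g, fun i => (s i).2, fun i x => ?_, ?_, ?_⟩
  · exact Complex.zero_le_real.2 (hh0 i x)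
  · ext x
    have := congrArg (fun r : ℝ => (r : ℂ)) (hh1 x)
    simpa [hg] using this
  · change ‖P a - sigma Γ ρ (condExp hρ a)‖ < ε
    have hPa₀ : P a₀ - sigma Γ ρ f₀ = ∑ i, (if t i = 1 then 0 else
        P (sigma Γ ρ (f i) * shift 𝓗 (t i))) + (P (sigma Γ ρ f₀) - sigma Γ ρ f₀) := by
      have h1 : P (sigma Γ ρ f₀) = ∑ i, if t i = 1 then
          P (sigma Γ ρ (f i) * shift 𝓗 (t i)) else 0 := by
        rw [hf₀_eq, sigma_sum, map_sum]
        refine Finset.sum_congr rfl fun i _ => ?_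
        split_ifs with hi
        · rw [hi, shift_one, mul_one]
        · rw [sigma_zero, map_zero]
      have h2 : P a₀ = ∑ i, P (sigma Γ ρ (f i) * shift 𝓗 (t i)) := by
        rw [ha₀, Submodule.coe_sum, map_sum]
        rfl
      rw [h1, h2, ← add_sub_assoc, ← Finset.sum_add_distrib]
      congr 1
      refine Finset.sum_congr rfl fun i _ => ?_
      split_ifs <;> simp
    have hmono : ‖∑ i, (if t i = 1 then 0 else P (sigma Γ ρ (f i) * shift 𝓗 (t i)))‖ ≤
        2 * δ * S := by
      rw [hS, Finset.mul_sum]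
      refine norm_sum_le_of_le _ fun i _ => ?_
      split_ifs with hi
      · rw [norm_zero]
        positivity
      · exact norm_average_monomial_le_of_isFactorMap ρ hY.toIsFactorMap _ h χ hh1 hχ
          (fun j => hχF j _ (Finset.mem_erase.2 ⟨hi, Finset.mem_image_of_mem t (Finset.mem_univ i)⟩))
          hδ.le hmass (f i)
    have hsig : ‖P (sigma Γ ρ f₀) - sigma Γ ρ f₀‖ ≤ δ ^ 2 := by
      rw [hP, average_sigma, ← sigma_sub]
      refine (norm_sigma_le ρ _).trans ((ContinuousMap.norm_le _ (sq_nonneg δ)).2 fun x => ?_)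
      simpa [hg, Subgroup.smul_def] using hmove x
    have hE : ‖sigma Γ ρ (f₀ - condExp hρ a)‖ < ε / 3 := by
      refine (norm_sigma_le ρ _).trans_lt ?_
      rw [hf₀, ← map_sub]
      exact (norm_condExp_le hρ _).trans_lt (norm_sub_rev a a₀ ▸ ha)
    have hPa : ‖P ((a - a₀ : reducedCrossedProduct Γ ρ) : L2 Γ 𝓗 →L[ℂ] L2 Γ 𝓗)‖ < ε / 3 :=
      (norm_average_le ρ _ h hh1 _).trans_lt (ha)
    have hsplit : P a - sigma Γ ρ (condExp hρ a) =
        P ((a - a₀ : reducedCrossedProduct Γ ρ) : L2 Γ 𝓗 →L[ℂ] L2 Γ 𝓗) +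
          (P a₀ - sigma Γ ρ f₀) + sigma Γ ρ (f₀ - condExp hρ a) := by
      rw [Submodule.coe_sub, map_sub, sigma_sub]
      abel
    have hmid : ‖P a₀ - sigma Γ ρ f₀‖ ≤ ε / 3 := by
      rw [hPa₀]
      refine (norm_add_le _ _).trans ?_
      nlinarith
    rw [hsplit]
    refine (norm_add₃_le).trans_lt ?_
    linarith
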